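/- For $n\ge 1$ let $MAJ_n:\{0,1\}^n\times\{0,1\}^n\to\{0,1\}$ be given by $MAJ_n(x,y)=1\iff\sum_{i=1}^n (x_i\wedge y_i)\ge n/2$. For $f:\{0,1\}^n\times\{0,1\}^n\to\{0,1\}$ let $BQC(f)$ denote the least number of qubits exchanged in a two-party quantum protocol without prior entanglement (Alice holds $x$, Bob holds $y$, each also holds finitely many work qubits initialized to $|0\rangle$; in each round one player applies a unitary to the qubits in his possession and sends one of them to the other player; at the end one player measures one of his qubits, possibly after a last unitary on his qubits, and the outcome is the output; all these choices are fixed in advance) whose output equals $f(x,y)$ with probability at least $2/3$ on every input $(x,y)$. Theorem. $BQC(MAJ_n)=\Omega(n/\log n)$; that is, there are a constant $c>0$ and an $N$ such that $BQC(MAJ_n)\ge c\,n/\log n$ for all $n\ge N$. -/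

import Mathlib

open scoped ENNReal

namespace QComm

/-- The two players. -/
inductive Player where
  | alice : Player
  | bob : Player
  deriving DecidableEq

/-- The opponent of a player. -/
def Player.other : Player → Player
  | .alice => .bob
  | .bob => .alice

/-- Amplitudes of a state of the qubits indexed by `Q`, in the computational basis `{0,1}^Q`
(`true` is `1`). -/
abbrev QState (Q : Type) : Type := (Q → Bool) → ℂ

/-- The qubits held by player `p` when qubit `q` belongs to `owner q`. -/
abbrev Held {Q : Type} (owner : Q → Player) (p : Player) : Type := {q : Q // owner q = p}

/-- A unitary transformation of the qubits held by player `p`. -/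
abbrev LocalUnitary {Q : Type} [Fintype Q] [DecidableEq Q] (owner : Q → Player) (p : Player) :
    Type :=
  Matrix.unitaryGroup (Held owner p → Bool) ℂ

/-- The operator `V ⊗ I` on all qubits: `V` acts on the qubits held by `p`, and the qubits held by
the other player are left alone. -/
def onHeld {Q : Type} [Fintype Q] [DecidableEq Q] (owner : Q → Player) (p : Player)
    (V : Matrix (Held owner p → Bool) (Held owner p → Bool) ℂ) :
    Matrix (Q → Bool) (Q → Bool) ℂ :=
  Matrix.of fun b b' =>
    if ∀ q, owner q ≠ p → b q = b' q then V (fun q => b q.1) (fun q => b' q.1) else 0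

/-- The course of a quantum protocol from the moment on when qubit `q` belongs to `owner q`.
In a communication round, player `p` applies a unitary to the qubits in his possession and then
sends one of them to the other player, which changes nothing but its possession. At the end,
one player measures one of his qubits, possibly after a last unitary on his qubits.
All choices are fixed in advance, independently of the input. -/
inductive Course (Q : Type) [Fintype Q] [DecidableEq Q] : (Q → Player) → Type where
  | measure {owner : Q → Player} (p : Player) (U : LocalUnitary owner p) (q : Held owner p) :
      Course Q owner
  | round {owner : Q → Player} (p : Player) (U : LocalUnitary owner p) (q : Held owner p)
      (rest : Course Q (Function.update owner q.1 p.other)) : Course Q owner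

namespace Course

/-- The number of qubits exchanged. -/
def cost {Q : Type} [Fintype Q] [DecidableEq Q] :
    {owner : Q → Player} → Course Q owner → ℕ
  | _, .measure _ _ _ => 0
  | _, .round _ _ _ rest => rest.cost + 1

/-- The probability that the final measurement (in the computational basis) yields `v`, when the
current state is `ψ`. -/
noncomputable def outputProb {Q : Type} [Fintype Q] [DecidableEq Q] (v : Bool) :
    {owner : Q → Player} → Course Q owner → QState Q → ℝ
  | owner, .measure p U q, ψ =>
      ∑ b : Q → Bool, if b q.1 = v then ‖(onHeld owner p U.1).mulVec ψ b‖ ^ 2 else 0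
  | owner, .round p U _ rest, ψ => rest.outputProb v ((onHeld owner p U.1).mulVec ψ)

end Course

/-- The qubits of a protocol for inputs `x, y ∈ {0,1}^n`: Alice holds `n` input qubits and `a`
work qubits, Bob holds `n` input qubits and `b` work qubits. -/
abbrev Qubits (n a b : ℕ) : Type := (Fin n ⊕ Fin a) ⊕ (Fin n ⊕ Fin b)

/-- The possession of the qubits before the protocol starts. -/
def initialOwner (n a b : ℕ) : Qubits n a b → Player
  | .inl _ => .alice
  | .inr _ => .bob

/-- The initial contents: the input qubits hold `x` and `y`, all work qubits hold `0`. -/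
def initialBits {n : ℕ} (a b : ℕ) (x y : Fin n → Bool) : Qubits n a b → Bool
  | .inl (.inl i) => x i
  | .inl (.inr _) => false
  | .inr (.inl i) => y i
  | .inr (.inr _) => false

/-- A quantum protocol (without prior entanglement) on inputs `x, y ∈ {0,1}^n`. -/
structure QuantumProtocol (n : ℕ) where
  /-- number of Alice's work qubits -/
  a : ℕ
  /-- number of Bob's work qubits -/
  b : ℕ
  /-- the actions of the players -/
  course : Course (Qubits n a b) (initialOwner n a b)

/-- The probability that the protocol outputs `v` on input `(x, y)`. -/
noncomputable def QuantumProtocol.outputProb {n : ℕ} (P : QuantumProtocol n)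
    (x y : Fin n → Bool) (v : Bool) : ℝ :=
  P.course.outputProb v (Pi.single (initialBits P.a P.b x y) 1)

/-- On every input the protocol gives the correct answer with probability at least `1 - ε`. -/
def QuantumProtocol.Computes {n : ℕ} (P : QuantumProtocol n) (ε : ℝ)
    (f : (Fin n → Bool) → (Fin n → Bool) → Bool) : Prop :=
  ∀ x y, 1 - ε ≤ P.outputProb x y (f x y)

/-- The quantum communication complexity of `f` with error `ε`: the least number of qubits
exchanged by a protocol that computes `f` with error `ε`. -/
noncomputable def BQCerr {n : ℕ} (ε : ℝ) (f : (Fin n → Bool) → (Fin n → Bool) → Bool) : ℕ∞ :=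
  ⨅ (P : QuantumProtocol n) (_ : P.Computes ε f), (P.course.cost : ℕ∞)

/-- The bounded-error quantum communication complexity (error `1/3`). -/
noncomputable def BQC {n : ℕ} (f : (Fin n → Bool) → (Fin n → Bool) → Bool) : ℕ∞ :=
  BQCerr (1 / 3) f

/-- `MAJ_n(x,y) = 1` iff `∑ i, (x_i ∧ y_i) ≥ n / 2`. -/
def MAJ (n : ℕ) (x y : Fin n → Bool) : Bool :=
  decide ((n : ℚ) / 2 ≤ ∑ i, ((x i && y i).toNat : ℚ))

end QComm

/-! The bound transfers the discrepancy bound for inner product mod 2 to majority. Write |x∧y| for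
the intersection size. When C qubits are exchanged, the state before the measurement is a sum of 2^C
products of one-player vectors of norm at most 1, because handing over a qubit splits each term by
the value of that qubit. Hence each output probability is a sum of 4^C products a(x)b(y) with values
in the unit disc (`QuantumProtocol.sumOfProducts_outputProb`).

Amplification is purely algebraic: the majority vote over 2l trials is a polynomial of degree 2l in
the two output probabilities. It has error at most (8/9)^l (`upperHalf_le`, `lowerHalf_le`), and
each of its monomials is again a sum of 4^(2lC) products. By Lindsey's lemma each product has
correlation at most 8^(m/2) with (-1)^|x∧y| on m-bit inputs (`abs_sum_innerSign_upperHalf_le`).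

After padding with ones, a protocol for majority on n bits decides |x∧y| ≥ T on m = n/3 bits for
every T ≤ m + 1. The tests for T and T + 1 differ by the indicator of |x∧y| = T. There the sign is
constant, so the correlation is the number of such pairs up to sign, at least 4^m/(m+1) for a
suitable T (`four_pow_div_le`). With l of order log n, comparing the two bounds forces C·l to be of
order n. -/

namespace QComm

/-! ### Product decomposition of protocol states and output probabilities -/

section ProductForm

variable {Q : Type} [Fintype Q] [DecidableEq Q]

theorem Player.eq_other_of_ne {r p : Player} (h : r ≠ p) : r = p.other := by
  cases r <;> cases p <;> simp_all [Player.other]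

theorem Player.other_ne (p : Player) : p.other ≠ p := by
  cases p <;> simp [Player.other]

/-- A basis state of all qubits is a pair of basis states, one for each player. -/
def splitBits (owner : Q → Player) (p : Player) :
    (Q → Bool) ≃ (Held owner p → Bool) × (Held owner p.other → Bool) where
  toFun b := (fun q => b q.1, fun q => b q.1)
  invFun c q := if h : owner q = p then c.1 ⟨q, h⟩ else c.2 ⟨q, Player.eq_other_of_ne h⟩
  left_inv b := by
    funext q
    by_cases h : owner q = p <;> simp [h]
  right_inv c := by
    refine Prod.ext ?_ ?_
    · funext q
      simp [q.2]
    · funext q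
      simp [q.2, Player.other_ne p]


theorem sum_eq_sum_splitBits {M : Type*} [AddCommMonoid M] (owner : Q → Player) (p : Player)
    (f : (Held owner p → Bool) → (Held owner p.other → Bool) → M) :
    ∑ b : Q → Bool, f (fun q => b q.1) (fun q => b q.1) = ∑ c, ∑ d, f c d := by
  rw [← Fintype.sum_prod_type']
  exact Equiv.sum_comp (splitBits owner p) (fun c => f c.1 c.2)

/-- `onHeld` acts on the first component of a state given on pairs of basis states. -/
theorem onHeld_mulVec (owner : Q → Player) (p : Player)
    (V : Matrix (Held owner p → Bool) (Held owner p → Bool) ℂ)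
    (φ : (Held owner p → Bool) → (Held owner p.other → Bool) → ℂ) (ψ : QState Q)
    (hψ : ∀ b, ψ b = φ (fun q => b q.1) (fun q => b q.1)) (b : Q → Bool) :
    (onHeld owner p V).mulVec ψ b =
      ∑ c, V (fun q => b q.1) c * φ c (fun q => b q.1) := by
  let f (c : Held owner p → Bool) (d : Held owner p.other → Bool) : ℂ :=
    if (fun q : Held owner p.other => b q.1) = d then V (fun q => b q.1) c * φ c d else 0
  have key : (onHeld owner p V).mulVec ψ b =
      ∑ b' : Q → Bool, f (fun q => b' q.1) (fun q => b' q.1) := by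
    refine Finset.sum_congr rfl fun b' _ => ?_
    have hiff : (∀ q, owner q ≠ p → b q = b' q) ↔
        (fun q : Held owner p.other => b q.1) = (fun q => b' q.1) := by
      constructor
      · intro h
        funext q
        exact h q.1 (by rw [q.2]; exact Player.other_ne p)
      · intro h q hq
        exact congrFun h ⟨q, Player.eq_other_of_ne hq⟩
    simp only [onHeld, Matrix.of_apply, hiff, hψ b', ite_mul, zero_mul, f]
  rw [key, sum_eq_sum_splitBits owner p f]
  simp [f]

theorem sum_norm_sq_unitary_mulVec {ι : Type*} [Fintype ι] [DecidableEq ι]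
    (U : Matrix.unitaryGroup ι ℂ) (v : ι → ℂ) :
    ∑ c, ‖U.1.mulVec v c‖ ^ 2 = ∑ c, ‖v c‖ ^ 2 := by
  have h (w : ι → ℂ) : ((∑ c, ‖w c‖ ^ 2 : ℝ) : ℂ) = star w ⬝ᵥ w := by
    simp [dotProduct, ← Complex.conj_mul']
  have hU : U.1.conjTranspose * U.1 = 1 := Matrix.mem_unitaryGroup_iff'.1 U.2
  apply Complex.ofReal_injective
  rw [h, h, Matrix.star_mulVec, Matrix.dotProduct_mulVec, Matrix.vecMul_vecMul, hU,
    Matrix.vecMul_one]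

theorem sum_norm_sq_onHeld_mulVec (owner : Q → Player) (p : Player) (U : LocalUnitary owner p)
    (ψ : QState Q) :
    ∑ b, ‖(onHeld owner p U.1).mulVec ψ b‖ ^ 2 = ∑ b, ‖ψ b‖ ^ 2 := by
  set φ : (Held owner p → Bool) → (Held owner p.other → Bool) → ℂ :=
    fun c d => ψ ((splitBits owner p).symm (c, d)) with hφ
  have hψ (b) : ψ b = φ (fun q => b q.1) (fun q => b q.1) :=
    (congrArg ψ ((splitBits owner p).symm_apply_apply b)).symm
  simp only [onHeld_mulVec owner p U.1 φ ψ hψ, hψ]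
  rw [sum_eq_sum_splitBits owner p (fun c d => ‖∑ c', U.1 c c' * φ c' d‖ ^ 2),
    sum_eq_sum_splitBits owner p (fun c d => ‖φ c d‖ ^ 2), Finset.sum_comm,
    Finset.sum_comm (f := fun c d => ‖φ c d‖ ^ 2)]
  exact Finset.sum_congr rfl fun d _ => sum_norm_sq_unitary_mulVec U (fun c => φ c d)

theorem Course.outputProb_true_add_false {owner : Q → Player} (C : Course Q owner)
    (ψ : QState Q) :
    C.outputProb true ψ + C.outputProb false ψ = ∑ b, ‖ψ b‖ ^ 2 := by
  induction C generalizing ψ with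
  | measure p U q =>
    simp only [Course.outputProb]
    rw [← sum_norm_sq_onHeld_mulVec _ p U ψ, ← Finset.sum_add_distrib]
    refine Finset.sum_congr rfl fun b _ => ?_
    cases b q.1 <;> simp
  | round p U q rest ih =>
    simp only [Course.outputProb]
    rw [ih, sum_norm_sq_onHeld_mulVec]

theorem Course.outputProb_nonneg {owner : Q → Player} (C : Course Q owner) (v : Bool)
    (ψ : QState Q) : 0 ≤ C.outputProb v ψ := by
  induction C generalizing ψ with
  | measure p U q =>
    exact Finset.sum_nonneg fun b _ => by split_ifs <;> positivity
  | round p U q rest ih => exact ih _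

/-- The states `Ψ z`, for inputs `z` of the two players, are sums of `K` products of a vector that
depends on the input of `p` only and a vector that depends on the input of the other player only,
all of norm at most `1`. -/
def ProductForm {X : Type} (owner : Q → Player) (p : Player) (K : ℕ)
    (Ψ : (Player → X) → QState Q) : Prop :=
  ∃ (ι : Type) (_ : Fintype ι) (A : ι → X → (Held owner p → Bool) → ℂ)
    (B : ι → X → (Held owner p.other → Bool) → ℂ),
    Fintype.card ι = K ∧ (∀ i x, ∑ c, ‖A i x c‖ ^ 2 ≤ 1) ∧ (∀ i x, ∑ c, ‖B i x c‖ ^ 2 ≤ 1) ∧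
    ∀ z b, Ψ z b = ∑ i, A i (z p) (fun q => b q.1) * B i (z p.other) (fun q => b q.1)

variable {X : Type} {owner : Q → Player} {p : Player} {K : ℕ} {Ψ : (Player → X) → QState Q}

theorem ProductForm.other (h : ProductForm owner p K Ψ) : ProductForm owner p.other K Ψ := by
  obtain ⟨ι, _, A, B, hK, hA, hB, h⟩ := h
  cases p
  all_goals
    refine ⟨ι, inferInstance, B, A, hK, hB, hA, fun z b => ?_⟩
    rw [h]
    exact Finset.sum_congr rfl fun i _ => mul_comm _ _

theorem ProductForm.of_player (h : ProductForm owner p K Ψ) (r : Player) :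
    ProductForm owner r K Ψ := by
  by_cases hr : r = p
  · exact hr ▸ h
  · exact Player.eq_other_of_ne hr ▸ h.other

theorem ProductForm.onHeld (h : ProductForm owner p K Ψ) (U : LocalUnitary owner p) :
    ProductForm owner p K (fun z => (onHeld owner p U.1).mulVec (Ψ z)) := by
  obtain ⟨ι, _, A, B, hK, hA, hB, h⟩ := h
  refine ⟨ι, inferInstance, fun i x => U.1.mulVec (A i x), B, hK, fun i x => ?_, hB,
    fun z b => ?_⟩
  · rw [sum_norm_sq_unitary_mulVec]
    exact hA i x
  · refine (onHeld_mulVec owner p U.1 (fun c d => ∑ i, A i (z p) c * B i (z p.other) d) (Ψ z)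
      (h z) b).trans ?_
    simp only [Matrix.mulVec, dotProduct, Finset.mul_sum, Finset.sum_mul, mul_assoc]
    exact Finset.sum_comm

theorem sum_comp_le_of_injOn {α β : Type*} [DecidableEq β] [Fintype β]
    (s : Finset α) (g : α → β) (hg : Set.InjOn g s) (f : β → ℝ) (hf : ∀ b, 0 ≤ f b) :
    ∑ a ∈ s, f (g a) ≤ ∑ b, f b := by
  rw [← Finset.sum_image hg]
  exact Finset.sum_le_univ_sum_of_nonneg hf

/-- Each term splits by the value v of the sent qubit: the sender's factor gets v plugged in, and
the receiver's factor is multiplied by the indicator that the qubit equals v. The new squared norms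
are sums over injectively embedded parts of the old index sets, so they do not grow. -/
theorem ProductForm.send (h : ProductForm owner p K Ψ) (q : Held owner p) :
    ProductForm (Function.update owner q.1 p.other) p (K * 2) Ψ := by
  obtain ⟨ι, _, A, B, hK, hA, hB, h⟩ := h
  set owner' := Function.update owner q.1 p.other with howner
  have hq : owner' q.1 = p.other := by simp [howner]
  have hne {s : Q} (hs : s ≠ q.1) : owner' s = owner s := by simp [howner, hs]
  have hoth {s : Q} (hs : owner s = p.other) : owner' s = p.other := by
    by_cases hsq : s = q.1
    · rw [hsq, hq]
    · rw [hne hsq, hs]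
  let ext (c : Held owner' p → Bool) (v : Bool) : Held owner p → Bool := fun s =>
    if hs : s.1 = q.1 then v else c ⟨s.1, (hne hs).trans s.2⟩
  let res (d : Held owner' p.other → Bool) : Held owner p.other → Bool := fun s =>
    d ⟨s.1, hoth s.2⟩
  refine ⟨ι × Bool, inferInstance, fun i x c => A i.1 x (ext c i.2),
    fun i x d => if d ⟨q.1, hq⟩ = i.2 then B i.1 x (res d) else 0, by simp [hK], ?_, ?_, ?_⟩
  · intro i x
    refine le_trans (sum_comp_le_of_injOn Finset.univ (fun c => ext c i.2) ?_
      (fun c => ‖A i.1 x c‖ ^ 2) (fun _ => by positivity)) (hA i.1 x)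
    intro c _ c' _ hcc
    funext s
    have hsq : s.1 ≠ q.1 := by
      intro hs
      have := s.2
      rw [hs, hq] at this
      exact Player.other_ne p this
    have := congrFun hcc ⟨s.1, (hne hsq).symm.trans s.2⟩
    simpa [ext, hsq] using this
  · intro i x
    have : ∀ d : Held owner' p.other → Bool,
        ‖if d ⟨q.1, hq⟩ = i.2 then B i.1 x (res d) else 0‖ ^ 2 =
          if d ⟨q.1, hq⟩ = i.2 then ‖B i.1 x (res d)‖ ^ 2 else 0 := by
      intro d
      split_ifs <;> simp
    simp only [this]
    rw [← Finset.sum_filter]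
    refine le_trans (sum_comp_le_of_injOn _ res ?_
      (fun c => ‖B i.1 x c‖ ^ 2) (fun _ => by positivity)) (hB i.1 x)
    intro d hd d' hd' hdd
    funext s
    simp only [Finset.coe_filter, Finset.mem_univ, true_and, Set.mem_ofPred_eq] at hd hd'
    by_cases hs : s = ⟨q.1, hq⟩
    · rw [hs, hd, hd']
    · have hsq : s.1 ≠ q.1 := fun h => hs (Subtype.ext h)
      exact congrFun hdd ⟨s.1, (hne hsq).symm.trans s.2⟩
  · intro z b
    rw [h, Fintype.sum_prod_type]
    refine Finset.sum_congr rfl fun i _ => ?_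
    have hext : ext (fun s => b s.1) (b q.1) = fun s => b s.1 := by
      funext s
      by_cases hs : s.1 = q.1 <;> simp [ext, hs]
    simp only [mul_ite, mul_zero, Finset.sum_ite_eq, Finset.mem_univ, if_true, hext]
    rfl

/-- A function of the inputs of the two players is a sum of `K` products of functions with values
in the unit disc, each depending on the input of one player only. -/
def SumOfProducts {X : Type} (K : ℕ) (R : X → X → ℂ) : Prop :=
  ∃ (ι : Type) (_ : Fintype ι) (a b : ι → X → ℂ), Fintype.card ι = K ∧
    (∀ i x, ‖a i x‖ ≤ 1) ∧ (∀ i x, ‖b i x‖ ≤ 1) ∧ ∀ x y, R x y = ∑ i, a i x * b i y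

theorem norm_sum_mul_star_le_one {α : Type*} (s : Finset α) (f g : α → ℂ)
    (hf : ∑ c ∈ s, ‖f c‖ ^ 2 ≤ 1) (hg : ∑ c ∈ s, ‖g c‖ ^ 2 ≤ 1) :
    ‖∑ c ∈ s, f c * star (g c)‖ ≤ 1 := by
  refine (norm_sum_le _ _).trans ?_
  simp only [norm_mul, norm_star]
  have := Finset.sum_mul_sq_le_sq_mul_sq s (fun c => ‖f c‖) (fun c => ‖g c‖)
  have h0 : 0 ≤ ∑ c ∈ s, ‖g c‖ ^ 2 := Finset.sum_nonneg fun _ _ => by positivity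
  have h1 : (∑ c ∈ s, ‖f c‖ * ‖g c‖) ^ 2 ≤ 1 :=
    this.trans (mul_le_one₀ hf h0 hg)
  exact (abs_le_one_iff_mul_self_le_one.2 (by rw [← sq]; exact h1)) |> le_of_abs_le

/-- The joint input of the two players. -/
def jointInput (x y : X) : Player → X
  | .alice => x
  | .bob => y

theorem SumOfProducts.of_player {R : X → X → ℂ} (p : Player) (ι : Type) [Fintype ι]
    (a b : ι → X → ℂ) (ha : ∀ i x, ‖a i x‖ ≤ 1) (hb : ∀ i x, ‖b i x‖ ≤ 1)
    (h : ∀ x y, R x y = ∑ i, a i (jointInput x y p) * b i (jointInput x y p.other)) :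
    SumOfProducts (Fintype.card ι) R := by
  cases p
  · exact ⟨ι, inferInstance, a, b, rfl, ha, hb, h⟩
  · refine ⟨ι, inferInstance, b, a, rfl, hb, ha, fun x y => ?_⟩
    rw [h]
    exact Finset.sum_congr rfl fun i _ => mul_comm _ _

/-- Expanding the squared modulus gives K² pairs of terms. For each pair the sum over basis states
factors into one inner product per player, and Cauchy-Schwarz keeps both in the unit disc. -/
theorem ProductForm.measure (h : ProductForm owner p K Ψ) (q : Held owner p) (v : Bool) :
    SumOfProducts (K ^ 2) fun x y =>
      ((∑ b : Q → Bool, if b q.1 = v then ‖Ψ (jointInput x y) b‖ ^ 2 else 0 : ℝ) : ℂ) := by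
  obtain ⟨ι, _, A, B, hK, hA, hB, h⟩ := h
  rw [show K ^ 2 = Fintype.card (ι × ι) by rw [Fintype.card_prod, hK, sq]]
  refine SumOfProducts.of_player p (ι × ι)
    (fun i x => ∑ c with c q = v, A i.1 x c * star (A i.2 x c))
    (fun i y => ∑ d, B i.1 y d * star (B i.2 y d)) (fun i x => ?_) (fun i y => ?_) fun x y => ?_
  · have (i : ι) : ∑ c with c q = v, ‖A i x c‖ ^ 2 ≤ 1 :=
      (Finset.sum_le_univ_sum_of_nonneg fun _ => by positivity).trans (hA i x)
    exact norm_sum_mul_star_le_one _ _ _ (this _) (this _)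
  · exact norm_sum_mul_star_le_one _ _ _ (hB _ _) (hB _ _)
  · set z := jointInput x y
    let f (c : Held owner p → Bool) (d : Held owner p.other → Bool) : ℂ :=
      ∑ i : ι × ι, (if c q = v then A i.1 (z p) c * star (A i.2 (z p) c) else 0) *
        (B i.1 (z p.other) d * star (B i.2 (z p.other) d))
    have key (b : Q → Bool) : ((if b q.1 = v then ‖Ψ z b‖ ^ 2 else 0 : ℝ) : ℂ) =
        f (fun q => b q.1) (fun q => b q.1) := by
      by_cases hb : b q.1 = v
      · simp only [hb, if_true, f]
        rw [Complex.ofReal_pow, ← Complex.mul_conj', h, map_sum, Finset.sum_mul_sum,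
          Fintype.sum_prod_type]
        refine Finset.sum_congr rfl fun i _ => Finset.sum_congr rfl fun j _ => ?_
        simp only [map_mul, RCLike.star_def]
        ring
      · simp [hb, f]
    rw [Complex.ofReal_sum]
    rw [Finset.sum_congr rfl fun b _ => key b, sum_eq_sum_splitBits owner p f]
    simp only [Finset.sum_filter, Finset.sum_mul_sum, f]
    rw [Finset.sum_comm (s := (Finset.univ : Finset (ι × ι)))]
    exact Finset.sum_congr rfl fun c _ => Finset.sum_comm

/-- Every round doubles the number of terms and the measurement squares it, hence the factor 4 per
qubit. -/
theorem Course.sumOfProducts_outputProb (C : Course Q owner) (v : Bool)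
    (h : ProductForm owner p K Ψ) :
    SumOfProducts (K ^ 2 * 4 ^ C.cost) fun x y =>
      ((C.outputProb v (Ψ (jointInput x y)) : ℝ) : ℂ) := by
  induction C generalizing Ψ K p with
  | measure r U q =>
    simpa [Course.outputProb, Course.cost] using ((h.of_player r).onHeld U).measure q v
  | round r U q rest ih =>
    have := ih (((h.of_player r).onHeld U).send q)
    rw [mul_pow, mul_assoc] at this
    rw [Course.cost, pow_succ' 4]
    exact this

end ProductForm

/-! ### Output probabilities of whole protocols -/

section Protocol

variable {n : ℕ}

theorem initialBits_productForm (a b : ℕ) :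
    ProductForm (X := Fin n → Bool) (initialOwner n a b) .alice 1
      fun z => Pi.single (initialBits a b (z .alice) (z .bob)) 1 := by
  refine ⟨Unit, inferInstance,
    -- The second `x` is a dummy: only the qubits of Alice are read here, and only those of Bob in
    -- the other factor.
    fun _ x c => if c = (fun q => initialBits a b x x q.1) then 1 else 0,
    fun _ y c => if c = (fun q => initialBits a b y y q.1) then 1 else 0, by simp, ?_, ?_, ?_⟩
  · intro _ x
    simp [apply_ite]
  · intro _ x
    simp [apply_ite]
  · intro z c
    have hiff : c = initialBits a b (z .alice) (z .bob) ↔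
        ((fun q : Held (initialOwner n a b) .alice => c q.1) =
          fun q => initialBits a b (z .alice) (z .alice) q.1) ∧
        ((fun q : Held (initialOwner n a b) .bob => c q.1) =
          fun q => initialBits a b (z .bob) (z .bob) q.1) := by
      constructor
      · rintro rfl
        constructor
        · funext ⟨q, hq⟩
          rcases q with (q | q) | (q | q) <;> first | rfl | cases hq
        · funext ⟨q, hq⟩
          rcases q with (q | q) | (q | q) <;> first | rfl | cases hq
      · rintro ⟨h1, h2⟩
        funext q
        rcases q with (q | q) | (q | q)
        · exact congrFun h1 ⟨.inl (.inl q), rfl⟩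
        · exact congrFun h1 ⟨.inl (.inr q), rfl⟩
        · exact congrFun h2 ⟨.inr (.inl q), rfl⟩
        · exact congrFun h2 ⟨.inr (.inr q), rfl⟩
    refine (Pi.single_apply _ _ _).trans ?_
    rw [Fintype.sum_unique, ite_mul, one_mul, zero_mul, if_congr hiff rfl rfl, ite_and]
    rfl

theorem QuantumProtocol.sumOfProducts_outputProb (P : QuantumProtocol n) (v : Bool) :
    SumOfProducts (4 ^ P.course.cost) fun x y => ((P.outputProb x y v : ℝ) : ℂ) := by
  have := P.course.sumOfProducts_outputProb v (initialBits_productForm P.a P.b)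
  rwa [one_pow, one_mul] at this

theorem QuantumProtocol.outputProb_true_add_false (P : QuantumProtocol n) (x y : Fin n → Bool) :
    P.outputProb x y true + P.outputProb x y false = 1 := by
  rw [QuantumProtocol.outputProb, QuantumProtocol.outputProb,
    Course.outputProb_true_add_false]
  simp [Pi.single_apply, apply_ite]

theorem QuantumProtocol.outputProb_nonneg (P : QuantumProtocol n) (x y : Fin n → Bool)
    (v : Bool) : 0 ≤ P.outputProb x y v :=
  P.course.outputProb_nonneg v _

end Protocol

end QComm

namespace QComm

/-! ### Amplification by a polynomial in the output probabilities -/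

section Amplification

variable {X : Type} {K L : ℕ} {R S : X → X → ℂ}

theorem SumOfProducts.mul (hR : SumOfProducts K R) (hS : SumOfProducts L S) :
    SumOfProducts (K * L) fun x y => R x y * S x y := by
  obtain ⟨ι, _, a, b, rfl, ha, hb, h⟩ := hR
  obtain ⟨κ, _, a', b', rfl, ha', hb', h'⟩ := hS
  refine ⟨ι × κ, inferInstance, fun i x => a i.1 x * a' i.2 x, fun i x => b i.1 x * b' i.2 x,
    by simp, fun i x => ?_, fun i x => ?_, fun x y => ?_⟩
  · rw [norm_mul]
    exact mul_le_one₀ (ha _ _) (norm_nonneg _) (ha' _ _)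
  · rw [norm_mul]
    exact mul_le_one₀ (hb _ _) (norm_nonneg _) (hb' _ _)
  · simp only [h, h', Finset.sum_mul_sum, Fintype.sum_prod_type]
    refine Finset.sum_congr rfl fun i _ => Finset.sum_congr rfl fun j _ => ?_
    ring

theorem SumOfProducts.pow (hR : SumOfProducts K R) (k : ℕ) :
    SumOfProducts (K ^ k) fun x y => R x y ^ k := by
  induction k with
  | zero => exact ⟨Unit, inferInstance, fun _ _ => 1, fun _ _ => 1, by simp⟩
  | succ k ih => simpa only [pow_succ] using ih.mul hR

theorem SumOfProducts.comp {Y : Type} (hR : SumOfProducts K R) (e : Y → X) :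
    SumOfProducts K fun x y => R (e x) (e y) := by
  obtain ⟨ι, _, a, b, hK, ha, hb, h⟩ := hR
  exact ⟨ι, inferInstance, fun i x => a i (e x), fun i x => b i (e x), hK, fun _ _ => ha _ _,
    fun _ _ => hb _ _, fun _ _ => h _ _⟩

/-- The probability of at least `l` ones in `2 * l` independent trials that yield a one with
probability `t` and a zero with probability `s`. -/
noncomputable def upperHalf (l : ℕ) (t s : ℝ) : ℝ :=
  ∑ k ∈ Finset.Icc l (2 * l), t ^ k * s ^ (2 * l - k) * ((2 * l).choose k : ℝ)

/-- The probability of more than `l` zeros in these trials. -/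
noncomputable def lowerHalf (l : ℕ) (t s : ℝ) : ℝ :=
  ∑ k ∈ Finset.range l, t ^ k * s ^ (2 * l - k) * ((2 * l).choose k : ℝ)

theorem lowerHalf_add_upperHalf (l : ℕ) {t s : ℝ} (h : t + s = 1) :
    lowerHalf l t s + upperHalf l t s = 1 := by
  have := add_pow t s (2 * l)
  rw [h, one_pow] at this
  rw [this, lowerHalf, upperHalf, ← Finset.Ico_add_one_right_eq_Icc]
  exact Finset.sum_range_add_sum_Ico _ (by omega)

theorem upperHalf_nonneg (l : ℕ) {t s : ℝ} (ht : 0 ≤ t) (hs : 0 ≤ s) : 0 ≤ upperHalf l t s :=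
  Finset.sum_nonneg fun _ _ => by positivity

theorem lowerHalf_nonneg (l : ℕ) {t s : ℝ} (ht : 0 ≤ t) (hs : 0 ≤ s) : 0 ≤ lowerHalf l t s :=
  Finset.sum_nonneg fun _ _ => by positivity

theorem mul_le_two_ninths {t s : ℝ} (h : t + s = 1) (ht : t ≤ 1 / 3) : t * s ≤ 2 / 9 := by
  obtain rfl : s = 1 - t := by linarith
  nlinarith

/-- Since t ≤ s, the surplus factors t can be traded for s until the exponents balance, and t(1-t)
is at most 2/9 for t ≤ 1/3. -/
theorem pow_mul_pow_le {t s : ℝ} (ht : 0 ≤ t) (h : t + s = 1) (ht3 : t ≤ 1 / 3) {i j l : ℕ}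
    (hij : i + j = 2 * l) (hi : l ≤ i) : t ^ i * s ^ j ≤ (2 / 9) ^ l := by
  obtain ⟨d, rfl⟩ := Nat.exists_eq_add_of_le hi
  obtain rfl : l = j + d := by omega
  have hs : 0 ≤ s := by linarith
  calc t ^ (j + d + d) * s ^ j = (t * s) ^ j * (t ^ d * t ^ d) := by ring
    _ ≤ (t * s) ^ j * (t ^ d * s ^ d) := by
        have : t ≤ s := by linarith
        gcongr
    _ = (t * s) ^ (j + d) := by ring
    _ ≤ (2 / 9) ^ (j + d) := pow_le_pow_left₀ (by positivity) (mul_le_two_ninths h ht3) _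

theorem sum_choose_le (l : ℕ) (s : Finset ℕ) (hs : s ⊆ Finset.range (2 * l + 1)) :
    ∑ k ∈ s, ((2 * l).choose k : ℝ) ≤ 4 ^ l := by
  calc ∑ k ∈ s, ((2 * l).choose k : ℝ) ≤ ∑ k ∈ Finset.range (2 * l + 1), ((2 * l).choose k : ℝ) :=
        Finset.sum_le_sum_of_subset_of_nonneg hs fun _ _ _ => by positivity
    _ = 4 ^ l := by
        have := Nat.sum_range_choose (2 * l)
        rw [pow_mul] at this
        exact_mod_cast this

theorem upperHalf_le (l : ℕ) {t s : ℝ} (ht : 0 ≤ t) (h : t + s = 1) (ht3 : t ≤ 1 / 3) :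
    upperHalf l t s ≤ (8 / 9) ^ l := by
  calc upperHalf l t s ≤ ∑ k ∈ Finset.Icc l (2 * l), (2 / 9 : ℝ) ^ l * ((2 * l).choose k : ℝ) := by
        refine Finset.sum_le_sum fun k hk => ?_
        rw [Finset.mem_Icc] at hk
        gcongr
        exact pow_mul_pow_le ht h ht3 (by omega) hk.1
    _ ≤ (2 / 9 : ℝ) ^ l * 4 ^ l := by
        rw [← Finset.mul_sum]
        gcongr
        refine sum_choose_le l _ fun k hk => ?_
        simp only [Finset.mem_Icc, Finset.mem_range] at hk ⊢
        omega
    _ = (8 / 9) ^ l := by rw [← mul_pow]; norm_num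

theorem lowerHalf_le (l : ℕ) {t s : ℝ} (hs : 0 ≤ s) (h : t + s = 1) (hs3 : s ≤ 1 / 3) :
    lowerHalf l t s ≤ (8 / 9) ^ l := by
  calc lowerHalf l t s ≤ ∑ k ∈ Finset.range l, (2 / 9 : ℝ) ^ l * ((2 * l).choose k : ℝ) := by
        refine Finset.sum_le_sum fun k hk => ?_
        rw [Finset.mem_range] at hk
        gcongr
        rw [mul_comm]
        exact pow_mul_pow_le hs (by linarith) hs3 (by omega) (by omega)
    _ ≤ (2 / 9 : ℝ) ^ l * 4 ^ l := by
        rw [← Finset.mul_sum]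
        gcongr
        refine sum_choose_le l _ fun k hk => ?_
        simp only [Finset.mem_range] at hk ⊢
        omega
    _ = (8 / 9) ^ l := by rw [← mul_pow]; norm_num

end Amplification

/-! ### Inner product mod 2: Lindsey's lemma and a frequent intersection size -/

section Parity

/-- `(-1)^{u ∧ v}`. -/
def bitSign (u v : Bool) : ℝ := if u && v then -1 else 1

/-- `(-1)^{∑ i, x_i ∧ y_i}`. -/
def innerSign {m : ℕ} (x y : Fin m → Bool) : ℝ := ∏ i, bitSign (x i) (y i)

/-- The number of `i` with `x_i = y_i = 1`. -/
def interCount {m : ℕ} (x y : Fin m → Bool) : ℕ := ∑ i, (x i && y i).toNat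

variable {m : ℕ}

theorem innerSign_eq_pow (x y : Fin m → Bool) : innerSign x y = (-1) ^ interCount x y := by
  rw [innerSign, interCount, ← Finset.prod_pow_eq_pow_sum]
  refine Finset.prod_congr rfl fun i _ => ?_
  cases x i <;> cases y i <;> simp [bitSign]

theorem abs_innerSign (x y : Fin m → Bool) : |innerSign x y| = 1 := by
  simp [innerSign_eq_pow]

theorem interCount_le (x y : Fin m → Bool) : interCount x y ≤ m := by
  calc interCount x y ≤ ∑ _i : Fin m, 1 := Finset.sum_le_sum fun i _ => Bool.toNat_le _
    _ = m := by simp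

theorem sum_innerSign_mul_innerSign (y y' : Fin m → Bool) :
    ∑ x, innerSign x y * innerSign x y' = if y = y' then 2 ^ m else 0 := by
  have h1 : ∑ x, innerSign x y * innerSign x y' =
      ∏ i, ∑ u, bitSign u (y i) * bitSign u (y' i) := by
    rw [Finset.prod_univ_sum, Fintype.piFinset_univ]
    simp only [innerSign, Finset.prod_mul_distrib]
  have h2 (u v : Bool) : ∑ w, bitSign w u * bitSign w v = if u = v then 2 else 0 := by
    cases u <;> cases v <;> norm_num [bitSign]
  rw [h1]
  simp only [h2]
  split_ifs with h
  · simp [h]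
  · obtain ⟨i, hi⟩ := Function.ne_iff.1 h
    exact Finset.prod_eq_zero (Finset.mem_univ i) (by simp [hi])

/-- Parseval's identity: the sign matrix has orthogonal columns of squared norm 2^m. -/
theorem sum_norm_sq_innerSign (b : (Fin m → Bool) → ℂ) :
    ∑ x, ‖∑ y, (innerSign x y : ℂ) * b y‖ ^ 2 = 2 ^ m * ∑ y, ‖b y‖ ^ 2 := by
  apply Complex.ofReal_injective
  push_cast
  have key (x : Fin m → Bool) : ((‖∑ y, (innerSign x y : ℂ) * b y‖ : ℂ)) ^ 2 =
      ∑ y, ∑ y', ((innerSign x y * innerSign x y' : ℝ) : ℂ) * (b y * star (b y')) := by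
    rw [← Complex.mul_conj', map_sum, Finset.sum_mul_sum]
    refine Finset.sum_congr rfl fun y _ => Finset.sum_congr rfl fun y' _ => ?_
    simp only [map_mul, Complex.conj_ofReal, RCLike.star_def]
    push_cast
    ring
  simp only [key]
  rw [Finset.sum_comm, Finset.mul_sum]
  refine Finset.sum_congr rfl fun y _ => ?_
  rw [Finset.sum_comm]
  simp only [← Finset.sum_mul, ← Complex.ofReal_sum, sum_innerSign_mul_innerSign]
  simp [apply_ite, ite_mul, Complex.mul_conj']

/-- Lindsey's lemma, for functions with values in the unit disc. -/
theorem norm_sum_innerSign_le (a b : (Fin m → Bool) → ℂ) (ha : ∀ x, ‖a x‖ ≤ 1)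
    (hb : ∀ y, ‖b y‖ ≤ 1) :
    ‖∑ x, ∑ y, (innerSign x y : ℂ) * (a x * b y)‖ ≤ √(8 ^ m) := by
  have hcard : ∑ _x : Fin m → Bool, (1 : ℝ) = 2 ^ m := by simp
  have h1 : ‖∑ x, ∑ y, (innerSign x y : ℂ) * (a x * b y)‖ ≤
      ∑ x, 1 * ‖∑ y, (innerSign x y : ℂ) * b y‖ := by
    refine (norm_sum_le _ _).trans (Finset.sum_le_sum fun x _ => ?_)
    have : ∑ y, (innerSign x y : ℂ) * (a x * b y) = a x * ∑ y, (innerSign x y : ℂ) * b y := by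
      rw [Finset.mul_sum]
      exact Finset.sum_congr rfl fun y _ => by ring
    rw [this, norm_mul]
    exact mul_le_mul_of_nonneg_right (ha x) (norm_nonneg _)
  refine h1.trans (Real.le_sqrt_of_sq_le ?_)
  refine (Finset.sum_mul_sq_le_sq_mul_sq _ _ _).trans ?_
  rw [sum_norm_sq_innerSign]
  have h2 : ∑ y, ‖b y‖ ^ 2 ≤ 2 ^ m := by
    rw [← hcard]
    exact Finset.sum_le_sum fun y _ => pow_le_one₀ (norm_nonneg _) (hb y)
  simp only [one_pow, hcard]
  calc (2 : ℝ) ^ m * (2 ^ m * ∑ y, ‖b y‖ ^ 2) ≤ 2 ^ m * (2 ^ m * 2 ^ m) := by gcongr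
    _ = 8 ^ m := by rw [← mul_pow, ← mul_pow]; norm_num

theorem SumOfProducts.norm_sum_innerSign_le {K : ℕ} {R : (Fin m → Bool) → (Fin m → Bool) → ℂ}
    (hR : SumOfProducts K R) :
    ‖∑ x, ∑ y, (innerSign x y : ℂ) * R x y‖ ≤ K * √(8 ^ m) := by
  obtain ⟨ι, _, a, b, rfl, ha, hb, h⟩ := hR
  have : ∑ x, ∑ y, (innerSign x y : ℂ) * R x y =
      ∑ i, ∑ x, ∑ y, (innerSign x y : ℂ) * (a i x * b i y) := by
    simp only [h, Finset.mul_sum]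
    rw [Finset.sum_comm' (t' := Finset.univ) (s' := fun _ => Finset.univ) (by simp)]
    rw [Finset.sum_comm (s := (Finset.univ : Finset ι)), Finset.sum_comm]
    exact Finset.sum_congr rfl fun x _ => Finset.sum_comm
  rw [this]
  refine (norm_sum_le _ _).trans ?_
  refine (Finset.sum_le_sum fun i _ => QComm.norm_sum_innerSign_le _ _ (ha i) (hb i)).trans ?_
  simp

/-- The correlation of the amplified acceptance probability with the inner product function. -/
theorem abs_sum_innerSign_upperHalf_le {K : ℕ} (l : ℕ)
    {t s : (Fin m → Bool) → (Fin m → Bool) → ℝ}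
    (ht : SumOfProducts K fun x y => (t x y : ℂ)) (hs : SumOfProducts K fun x y => (s x y : ℂ)) :
    |∑ x, ∑ y, innerSign x y * upperHalf l (t x y) (s x y)| ≤ (2 * K : ℝ) ^ (2 * l) * √(8 ^ m) := by
  have h1 : ∑ x, ∑ y, innerSign x y * upperHalf l (t x y) (s x y) =
      ∑ k ∈ Finset.Icc l (2 * l), ((2 * l).choose k : ℝ) *
        ∑ x, ∑ y, innerSign x y * (t x y ^ k * s x y ^ (2 * l - k)) := by
    simp only [upperHalf, Finset.mul_sum]
    rw [Finset.sum_comm (s := Finset.Icc l (2 * l))]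
    refine Finset.sum_congr rfl fun x _ => ?_
    rw [Finset.sum_comm]
    refine Finset.sum_congr rfl fun k _ => Finset.sum_congr rfl fun y _ => ?_
    ring
  have h2 {k : ℕ} (hk : k ∈ Finset.Icc l (2 * l)) :
      |∑ x, ∑ y, innerSign x y * (t x y ^ k * s x y ^ (2 * l - k))| ≤
        (K : ℝ) ^ (2 * l) * √(8 ^ m) := by
    have := ((ht.pow k).mul (hs.pow (2 * l - k))).norm_sum_innerSign_le
    -- The exponents add up to 2l, so every monomial has the same number of product terms.
    rw [← pow_add, Nat.add_sub_cancel' (Finset.mem_Icc.1 hk).2] at this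
    rw [← Real.norm_eq_abs, ← Complex.norm_real]
    push_cast at this ⊢
    exact this
  rw [h1]
  calc _ ≤ ∑ k ∈ Finset.Icc l (2 * l), ((2 * l).choose k : ℝ) * ((K : ℝ) ^ (2 * l) * √(8 ^ m)) := by
        refine (Finset.abs_sum_le_sum_abs _ _).trans (Finset.sum_le_sum fun k hk => ?_)
        rw [abs_mul, Nat.abs_cast]
        gcongr
        exact h2 hk
    _ ≤ 4 ^ l * ((K : ℝ) ^ (2 * l) * √(8 ^ m)) := by
        rw [← Finset.sum_mul]
        gcongr
        refine sum_choose_le l _ fun k hk => ?_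
        simp only [Finset.mem_Icc, Finset.mem_range] at hk ⊢
        omega
    _ = _ := by rw [mul_pow, pow_mul 2]; norm_num; ring

/-- Some value of the intersection size has probability at least `1 / (m + 1)`. -/
theorem exists_interCount_frequent (m : ℕ) : ∃ T ≤ m,
    4 ^ m / (m + 1 : ℝ) ≤ ∑ x : Fin m → Bool, ∑ y, if interCount x y = T then (1 : ℝ) else 0 := by
  by_contra! hcon
  have h1 : ∑ T ∈ Finset.range (m + 1),
      ∑ x : Fin m → Bool, ∑ y, (if interCount x y = T then (1 : ℝ) else 0) = 4 ^ m := by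
    rw [Finset.sum_comm]
    have (x : Fin m → Bool) : ∑ T ∈ Finset.range (m + 1),
        ∑ y, (if interCount x y = T then (1 : ℝ) else 0) = 2 ^ m := by
      rw [Finset.sum_comm]
      simp [Nat.lt_succ_of_le (interCount_le _ _)]
    simp only [this]
    simp [← mul_pow]
    norm_num
  have h2 := Finset.sum_lt_sum_of_nonempty (s := Finset.range (m + 1)) (by simp)
    fun T hT => hcon T (Nat.lt_succ_iff.1 (Finset.mem_range.1 hT))
  rw [h1] at h2
  simp only [Finset.sum_const, Finset.card_range, nsmul_eq_mul] at h2
  push_cast at h2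
  rw [mul_div_cancel₀ _ (by positivity)] at h2
  exact lt_irrefl _ h2

end Parity

/-! ### Reduction of threshold tests to majority -/

section Padding

/-- `x` followed by `k` ones and then by zeros. -/
def padOnes {m : ℕ} (r k : ℕ) (x : Fin m → Bool) : Fin (m + r) → Bool :=
  Fin.append x fun j => decide (j.1 < k)

theorem interCount_padOnes {m r k : ℕ} (hk : k ≤ r) (x y : Fin m → Bool) :
    interCount (padOnes r k x) (padOnes r k y) = interCount x y + k := by
  rw [interCount, Fin.sum_univ_add]
  simp only [padOnes, Fin.append_left, Fin.append_right, Bool.and_self, interCount]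
  congr 1
  rw [Fin.sum_univ_eq_sum_range (fun j => (decide (j < k)).toNat) r]
  simp only [Bool.toNat, Bool.cond_decide]
  rw [← Finset.card_filter]
  have : Finset.filter (fun j => j < k) (Finset.range r) = Finset.range k := by
    ext j
    simp only [Finset.mem_filter, Finset.mem_range]
    omega
  rw [this, Finset.card_range]

theorem MAJ_eq {n : ℕ} (x y : Fin n → Bool) : MAJ n x y = decide (n ≤ 2 * interCount x y) := by
  rw [MAJ, interCount, decide_eq_decide, div_le_iff₀ (by norm_num), mul_comm]
  norm_cast

/-- Here (m + r + 1) / 2 is n/2 rounded up, for n = m + r. The padding supplies all but T of the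
common ones needed; the hypotheses say that this number is nonnegative and fits into r positions. -/
theorem MAJ_padOnes {m r T : ℕ} (hT : T ≤ (m + r + 1) / 2) (hr : (m + r + 1) / 2 ≤ r + T)
    (x y : Fin m → Bool) :
    MAJ (m + r) (padOnes r ((m + r + 1) / 2 - T) x) (padOnes r ((m + r + 1) / 2 - T) y) =
      decide (T ≤ interCount x y) := by
  rw [MAJ_eq, interCount_padOnes (by omega), decide_eq_decide]
  omega

end Padding

end QComm

namespace QComm

/-! ### The lower bound for majority -/

section Majority

/-- The amplified acceptance probability on padded inputs approximates the threshold test pointwise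
within (8/9)^l. The first summand is this error over all 4^m pairs, the second the correlation of
the approximant. S = m + 1 is allowed because S = T + 1 with T = m can occur. -/
theorem abs_sum_innerSign_threshold_le {m r l S : ℕ} (P : QuantumProtocol (m + r))
    (hP : P.Computes (1 / 3) (MAJ (m + r))) (hm : m + 1 ≤ (m + r + 1) / 2)
    (hr : (m + r + 1) / 2 ≤ r) (hS : S ≤ m + 1) :
    |∑ x : Fin m → Bool, ∑ y, innerSign x y * if S ≤ interCount x y then 1 else 0| ≤
      4 ^ m * (8 / 9) ^ l + (2 * 4 ^ P.course.cost : ℝ) ^ (2 * l) * √(8 ^ m) := by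
  set e : (Fin m → Bool) → Fin (m + r) → Bool := padOnes r ((m + r + 1) / 2 - S)
  set G : (Fin m → Bool) → (Fin m → Bool) → ℝ := fun x y =>
    upperHalf l (P.outputProb (e x) (e y) true) (P.outputProb (e x) (e y) false) with hG
  have hcorr : |∑ x, ∑ y, innerSign x y * G x y| ≤
      (2 * 4 ^ P.course.cost : ℝ) ^ (2 * l) * √(8 ^ m) := by
    have := abs_sum_innerSign_upperHalf_le l ((P.sumOfProducts_outputProb true).comp e)
      ((P.sumOfProducts_outputProb false).comp e)
    exact_mod_cast this
  have happrox (x y : Fin m → Bool) :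
      |(if S ≤ interCount x y then 1 else 0) - G x y| ≤ (8 / 9) ^ l := by
    have hsum := P.outputProb_true_add_false (e x) (e y)
    have ht := P.outputProb_nonneg (e x) (e y) true
    have hs := P.outputProb_nonneg (e x) (e y) false
    have hLU := lowerHalf_add_upperHalf l hsum
    have hc := hP (e x) (e y)
    rw [MAJ_padOnes (by omega) (by omega)] at hc
    split_ifs with h
    · simp only [h, decide_true] at hc
      have h1 := lowerHalf_le l hs hsum (by linarith)
      have h2 := lowerHalf_nonneg l ht hs
      rw [abs_of_nonneg] <;> simp only [hG] <;> linarith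
    · simp only [h, decide_false] at hc
      have h1 := upperHalf_le l ht hsum (by linarith)
      have h2 := upperHalf_nonneg l ht hs
      rw [zero_sub, abs_neg, abs_of_nonneg] <;> simp only [hG] <;> linarith
  have hsplit : ∑ x : Fin m → Bool, ∑ y, innerSign x y * (if S ≤ interCount x y then 1 else 0) =
      ∑ x : Fin m → Bool, ∑ y,
        innerSign x y * ((if S ≤ interCount x y then 1 else 0) - G x y) +
      ∑ x, ∑ y, innerSign x y * G x y := by
    simp only [← Finset.sum_add_distrib, mul_sub, sub_add_cancel]
  rw [hsplit]
  refine (abs_add_le _ _).trans (add_le_add ?_ hcorr)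
  calc _ ≤ ∑ _x : Fin m → Bool, ∑ _y : Fin m → Bool, (8 / 9 : ℝ) ^ l := by
        refine (Finset.abs_sum_le_sum_abs _ _).trans (Finset.sum_le_sum fun x _ => ?_)
        refine (Finset.abs_sum_le_sum_abs _ _).trans (Finset.sum_le_sum fun y _ => ?_)
        rw [abs_mul, abs_innerSign, one_mul]
        exact happrox x y
    _ = 4 ^ m * (8 / 9) ^ l := by
        simp only [Finset.sum_const, Finset.card_univ, Fintype.card_fun, Fintype.card_bool,
          Fintype.card_fin, nsmul_eq_mul]
        rw [← mul_assoc, ← Nat.cast_mul, ← mul_pow]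
        norm_num

theorem four_pow_div_le {m r : ℕ} (l : ℕ) (P : QuantumProtocol (m + r))
    (hP : P.Computes (1 / 3) (MAJ (m + r))) (hm : m + 1 ≤ (m + r + 1) / 2)
    (hr : (m + r + 1) / 2 ≤ r) :
    4 ^ m / (m + 1 : ℝ) ≤
      2 * (4 ^ m * (8 / 9) ^ l + (2 * 4 ^ P.course.cost : ℝ) ^ (2 * l) * √(8 ^ m)) := by
  obtain ⟨T, hT, hle⟩ := exists_interCount_frequent m
  refine hle.trans ?_
  have h1 := abs_sum_innerSign_threshold_le (l := l) P hP hm hr (S := T) (by omega)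
  have h2 := abs_sum_innerSign_threshold_le (l := l) P hP hm hr (S := T + 1) (by omega)
  have key : (-1) ^ T * ∑ x : Fin m → Bool, ∑ y, (if interCount x y = T then (1 : ℝ) else 0) =
      ∑ x : Fin m → Bool, ∑ y, (innerSign x y * if T ≤ interCount x y then 1 else 0) -
      ∑ x : Fin m → Bool, ∑ y, (innerSign x y * if T + 1 ≤ interCount x y then 1 else 0) := by
    simp only [← Finset.sum_sub_distrib, Finset.mul_sum]
    refine Finset.sum_congr rfl fun x _ => Finset.sum_congr rfl fun y _ => ?_
    rw [innerSign_eq_pow]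
    rcases lt_trichotomy (interCount x y) T with h | h | h
    · rw [if_neg (by omega), if_neg (by omega), if_neg (by omega)]
      ring
    · rw [if_pos h, if_pos (by omega), if_neg (by omega), h]
      ring
    · rw [if_neg (by omega), if_pos (by omega), if_pos (by omega)]
      ring
  refine (le_abs_self _).trans ?_
  have habs (a : ℝ) : |a| = |(-1) ^ T * a| := by simp [abs_mul]
  rw [habs, key, two_mul]
  exact (abs_sub _ _).trans (add_le_add h1 h2)

theorem log_inequality_of_computes {n m r l : ℕ} (hn : n = m + r) (P : QuantumProtocol n)
    (hP : P.Computes (1 / 3) (MAJ n)) (hm : m + 1 ≤ (m + r + 1) / 2)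
    (hr : (m + r + 1) / 2 ≤ r) (hl : (8 / 9 : ℝ) ^ l ≤ 1 / (4 * (m + 1))) :
    m * Real.log 2 ≤
      2 * Real.log (4 * (m + 1)) + 4 * l * (2 * P.course.cost + 1) * Real.log 2 := by
  subst hn
  have hmain := four_pow_div_le l P hP hm hr
  set C := P.course.cost
  have h1 : (4 : ℝ) ^ m ≤ 4 * (m + 1) * (2 * 4 ^ C) ^ (2 * l) * √(8 ^ m) := by
    have h2 : (4 : ℝ) ^ m * (8 / 9) ^ l ≤ 4 ^ m * (1 / (4 * (m + 1))) := by gcongr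
    have h3 : (4 : ℝ) ^ m / (m + 1) ≤
        -- By the choice of l, the approximation error absorbs at most half of the left side.
        4 ^ m / (m + 1) / 2 + 2 * ((2 * 4 ^ C) ^ (2 * l) * √(8 ^ m)) := by
      have : (4 : ℝ) ^ m * (1 / (4 * (m + 1))) = 4 ^ m / (m + 1) / 4 := by
        field_simp
      linarith
    have h4 : (4 : ℝ) ^ m / (m + 1) ≤ 4 * ((2 * 4 ^ C) ^ (2 * l) * √(8 ^ m)) := by linarith
    rw [div_le_iff₀ (by positivity)] at h4
    linarith
  have h5 : (2 : ℝ) ^ m ≤ (4 * (m + 1)) ^ 2 * 2 ^ (4 * l * (2 * C + 1)) := by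
    -- Squaring removes the root; 16^m / 8^m leaves 2^m.
    have h6 := pow_le_pow_left₀ (by positivity) h1 2
    rw [mul_pow, Real.sq_sqrt (by positivity), mul_pow] at h6
    have h7 : ((4 : ℝ) ^ m) ^ 2 = 2 ^ m * 8 ^ m := by
      rw [← pow_mul, mul_comm m 2, pow_mul, ← mul_pow]
      norm_num
    have h8 : (((2 : ℝ) * 4 ^ C) ^ (2 * l)) ^ 2 = 2 ^ (4 * l * (2 * C + 1)) := by
      rw [show (2 : ℝ) * 4 ^ C = 2 ^ (2 * C + 1) by rw [pow_succ', pow_mul]; norm_num,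
        ← pow_mul, ← pow_mul]
      congr 1
      ring
    rw [h7, h8] at h6
    exact le_of_mul_le_mul_right h6 (by positivity)
  have h9 := Real.log_le_log (by positivity) h5
  rw [Real.log_mul (by positivity) (by positivity), Real.log_pow, Real.log_pow,
    Real.log_pow] at h9
  push_cast at h9
  linarith

theorem eight_ninths_pow_le (l : ℕ) : (8 / 9 : ℝ) ^ l ≤ Real.exp (-(l / 9)) := by
  have h : (8 / 9 : ℝ) ≤ Real.exp (-(1 / 9)) := by
    have := Real.add_one_le_exp (-(1 / 9) : ℝ)
    linarith
  calc (8 / 9 : ℝ) ^ l ≤ Real.exp (-(1 / 9)) ^ l := pow_le_pow_left₀ (by norm_num) h l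
    _ = Real.exp (-(l / 9)) := by
        rw [← Real.exp_nat_mul]
        congr 1
        ring

theorem div_log_le_cost {n : ℕ} (hn : 12 ≤ n) (hlarge : 672 * Real.log n ≤ n)
    (P : QuantumProtocol n) (hP : P.Computes (1 / 3) (MAJ n)) :
    1 / 1216 * ((n : ℝ) / Real.log n) ≤ P.course.cost := by
  -- With m = n/3, every threshold up to m + 1 lies below n/2, and the padding has room for n/2
  -- ones.
  obtain ⟨m, r, hmr, hm⟩ : ∃ m r, n = m + r ∧ m = n / 3 :=
    ⟨n / 3, n - n / 3, by omega, rfl⟩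
  set C := P.course.cost
  have hn12 : (12 : ℝ) ≤ n := by exact_mod_cast hn
  have hL : 1 ≤ Real.log n := by
    rw [Real.le_log_iff_exp_le (by linarith)]
    linarith [Real.exp_one_lt_d9]
  set L := Real.log n with hL_def
  have hmn : (4 : ℝ) * (m + 1) ≤ n ^ 2 := by
    have : (m : ℝ) + 1 ≤ n := by exact_mod_cast (by omega : m + 1 ≤ n)
    nlinarith
  have hm4 : (n : ℝ) / 4 ≤ m := by
    rw [div_le_iff₀ (by norm_num)]
    exact_mod_cast (by omega : n ≤ m * 4)
  -- The constant 18 makes l/9 ≥ 2 log n, so the error is at most n^(-2).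
  have hl1 : 18 * L ≤ (⌈18 * L⌉₊ : ℝ) := Nat.le_ceil _
  have hl2 : (⌈18 * L⌉₊ : ℝ) ≤ 19 * L := by
    linarith [Nat.ceil_lt_add_one (a := 18 * L) (by linarith)]
  set l := ⌈18 * L⌉₊
  have hl : (8 / 9 : ℝ) ^ l ≤ 1 / (4 * (m + 1)) := by
    calc (8 / 9 : ℝ) ^ l ≤ Real.exp (-(l / 9)) := eight_ninths_pow_le l
      _ ≤ Real.exp (-(L + L)) := Real.exp_le_exp.2 (by linarith)
      _ = 1 / (n : ℝ) ^ 2 := by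
          rw [Real.exp_neg, Real.exp_add, hL_def, Real.exp_log (by linarith), ← sq, one_div]
      _ ≤ 1 / (4 * (m + 1)) := one_div_le_one_div_of_le (by positivity) hmn
  have hmain := log_inequality_of_computes hmr P hP (by omega) (by omega) hl
  have hlog2 : 1 / 2 ≤ Real.log 2 := by linarith [Real.log_two_gt_d9]
  have hlogm : Real.log (4 * (m + 1)) ≤ 2 * L := by
    have := Real.log_le_log (by positivity) hmn
    rw [Real.log_pow] at this
    exact_mod_cast this
  have hC : (0 : ℝ) ≤ C := Nat.cast_nonneg _
  have h1 : (m : ℝ) * Real.log 2 ≤ (8 * L + 4 * (19 * L) * (2 * C + 1)) * Real.log 2 := by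
    have h2 : 4 * (l : ℝ) * (2 * C + 1) * Real.log 2 ≤
        4 * (19 * L) * (2 * C + 1) * Real.log 2 := by gcongr
    have h3 : 4 * L ≤ 8 * L * Real.log 2 := by nlinarith
    linarith
  have h4 := le_of_mul_le_mul_right h1 (by linarith)
  -- Now n/4 ≤ m ≤ 84L + 152LC. As 672 = 8·84, the term 84L is at most n/8, so n/8 ≤ 152LC, and 1216
  -- = 8·152.
  rw [← mul_div_assoc, div_le_iff₀ (by linarith)]
  nlinarith

theorem exists_log_le : ∃ N : ℕ, 12 ≤ N ∧ ∀ n : ℕ, N ≤ n → 672 * Real.log n ≤ n := by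
  have h := (Real.isLittleO_log_id_atTop.bound (by norm_num : (0 : ℝ) < 1 / 672)).natCast_atTop
  obtain ⟨N, hN⟩ := Filter.eventually_atTop.1 h
  refine ⟨max N 12, le_max_right _ _, fun n hn => ?_⟩
  have := (le_abs_self _).trans (hN n ((le_max_left _ _).trans hn))
  simp only [id, Real.norm_eq_abs, Nat.abs_cast] at this
  linarith

end Majority

end QComm

theorem mainTheorem8 :
    ∃ c : ℝ, 0 < c ∧ ∃ N : ℕ, ∀ n : ℕ, N ≤ n →
      ENNReal.ofReal (c * ((n : ℝ) / Real.log (n : ℝ))) ≤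
        ((QComm.BQC (QComm.MAJ n) : ℕ∞) : ℝ≥0∞) := by
  obtain ⟨N, hN12, hN⟩ := QComm.exists_log_le
  refine ⟨1 / 1216, by norm_num, N, fun n hn => ?_⟩
  -- Costs are integers, so the real bound may be rounded up and compared with the infimum inside
  -- `ℕ∞`.
  have h : ((⌈1 / 1216 * ((n : ℝ) / Real.log n)⌉₊ : ℕ) : ℕ∞) ≤ QComm.BQC (QComm.MAJ n) :=
    le_iInf₂ fun P hP => Nat.cast_le.2 <| Nat.ceil_le.2 <|
      QComm.div_log_le_cost (hN12.trans hn) (hN n hn) P hP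
  calc ENNReal.ofReal (1 / 1216 * ((n : ℝ) / Real.log n))
      ≤ ENNReal.ofReal (⌈1 / 1216 * ((n : ℝ) / Real.log n)⌉₊ : ℝ) :=
        ENNReal.ofReal_le_ofReal (Nat.le_ceil _)
    _ = ((⌈1 / 1216 * ((n : ℝ) / Real.log n)⌉₊ : ℕ∞) : ℝ≥0∞) := by
        rw [ENNReal.ofReal_natCast, ENat.toENNReal_coe]
    _ ≤ _ := ENat.toENNReal_le.2 h
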